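/- Let $s,d$ be integers with $1\le s\le d$ and let $\sigma>0$. One observes $y_j=\theta_j+\sigma\xi_j$, $j=1,\dots,d$, where $\theta=(\theta_1,\dots,\theta_d)\in\mathbb R^d$ is unknown and $\xi_1,\dots,\xi_d$ are i.i.d. standard normal random variables; $\mathbf E_\theta$ denotes the expectation with respect to the law of $y=(y_1,\dots,y_d)$. Let $B_0(s)$ be the set of all $\theta\in\mathbb R^d$ with at most $s$ non-zero components, and put $$\psi_\sigma(s,d)=\begin{cases}\sigma^2 s\log(1+d/s^2) & \text{if } s<\sqrt d,\\ \sigma^2\sqrt d & \text{if } s\ge\sqrt d.\end{cases}$$ Let $x=\sqrt{2\log(1+d/s^2)}$, let $\alpha_s=\mathbf E(X^2\mid |X|>x)$ for a standard normal random variable $X$, and define the estimator $\hat N=\sqrt{\max\{\hat Q,0\}}$, where $$\hat Q=\begin{cases}\sum_{j=1}^d (y_j^2-\alpha_s\sigma^2)\,\mathbf 1_{\{|y_j|>\sigma x\}} & \text{if } s<\sqrt d,\\ \sum_{j=1}^d y_j^2-d\sigma^2 & \text{if } s\ge\sqrt d.\end{cases}$$ Then there exist absolute constants $c>0$ and $C>0$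 such that, for all integers $s,d$ with $1\le s\le d$ and all $\sigma>0$, the function $\hat N$ of $y$ is measurable, $$\sup_{\theta\in B_0(s)}\mathbf E_\theta\big(\hat N-\|\theta\|_2\big)^2\le C\,\psi_\sigma(s,d),$$ and $$\inf_{\hat T}\ \sup_{\theta\in B_0(s)}\mathbf E_\theta\big(\hat T-\|\theta\|_2\big)^2\ge c\,\psi_\sigma(s,d),$$ where the infimum is over all estimators $\hat T$, that is, over all measurable real-valued functions of $y$. -/

import Mathlib

open MeasureTheory ProbabilityTheory

noncomputable section

namespace SparseNorm

/-- The law `P_θ` of the observations `y_j = θ_j + σ ξ_j`, `j = 1, …, d`, where the `ξ_j` are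
i.i.d. standard normal. -/
def obsLaw {d : ℕ} (θ : EuclideanSpace ℝ (Fin d)) (σ : ℝ) : Measure (Fin d → ℝ) :=
  (Measure.pi fun _ : Fin d => gaussianReal 0 1).map fun ξ j => θ j + σ * ξ j

/-- The class `B_0(s)` of vectors with at most `s` non-zero components. -/
def sparseClass (s d : ℕ) : Set (EuclideanSpace ℝ (Fin d)) :=
  {θ | hammingNorm (fun j => θ j) ≤ s}

/-- The maximum squared risk over `Θ` of `That` as an estimator of the functional `T`. It takes
values in `[0, ∞]`, so no integrability has to be presupposed. -/
def maxRisk {d : ℕ} (σ : ℝ) (Θ : Set (EuclideanSpace ℝ (Fin d)))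
    (T : EuclideanSpace ℝ (Fin d) → ℝ) (That : (Fin d → ℝ) → ℝ) : ENNReal :=
  ⨆ θ ∈ Θ, ∫⁻ y, ENNReal.ofReal ((That y - T θ) ^ 2) ∂(obsLaw θ σ)

/-- The minimax squared risk over `Θ` for the functional `T`: the infimum of the maximum risk over
all estimators, that is, over all measurable functions of the observations. -/
def minimaxRisk {d : ℕ} (σ : ℝ) (Θ : Set (EuclideanSpace ℝ (Fin d)))
    (T : EuclideanSpace ℝ (Fin d) → ℝ) : ENNReal :=
  ⨅ (That : (Fin d → ℝ) → ℝ) (_ : Measurable That), maxRisk σ Θ T That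

/-- The number `√(2 log (1 + d / s²))`. -/
def threshold (s d : ℕ) : ℝ :=
  √(2 * Real.log (1 + (d : ℝ) / (s : ℝ) ^ 2))

/-- The conditional second moment `E (X² | |X| > x)` with `x = √(2 log (1 + d / s²))`, for a
standard normal variable `X`. -/
def alpha (s d : ℕ) : ℝ :=
  (∫ x in {x : ℝ | threshold s d < |x|}, x ^ 2 ∂(gaussianReal 0 1)) /
    (gaussianReal 0 1).real {x : ℝ | threshold s d < |x|}

/-- The estimator of `‖θ‖₂²`: thresholded and bias-corrected for `s < √d`, and only bias-corrected
for `s ≥ √d`. -/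
def quadEstimator (s d : ℕ) (σ : ℝ) (y : Fin d → ℝ) : ℝ :=
  if (s : ℝ) < √(d : ℝ) then
    ∑ j, if σ * threshold s d < |y j| then y j ^ 2 - alpha s d * σ ^ 2 else 0
  else
    ∑ j, y j ^ 2 - d * σ ^ 2

/-- The estimator of `‖θ‖₂`. -/
def normEstimator (s d : ℕ) (σ : ℝ) (y : Fin d → ℝ) : ℝ :=
  √(max (quadEstimator s d σ y) 0)

/-- The rate: `σ² s log (1 + d / s²)` if `s < √d`, and `σ² √d` if `s ≥ √d`. -/
def normRate (s d : ℕ) (σ : ℝ) : ℝ :=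
  if (s : ℝ) < √(d : ℝ) then
    σ ^ 2 * s * Real.log (1 + (d : ℝ) / (s : ℝ) ^ 2)
  else
    σ ^ 2 * √(d : ℝ)

end SparseNorm

end

/-!
Upper bound. Scaling reduces to `σ = 1`. If `Q̂` is close to `u²` for some `u ≥ 0`, then `N̂` is
close to `u`, at the cost of a square root only: `(N̂ - u)² ≤ |Q̂ - u²|`. In the dense regime take
`u = |‖θ‖ + β|`, where `β` is the noise in the direction of `θ`: then `Q̂ - u²` is a centred
chi-square variable minus `β²`, and `u` is within `|β|` of `‖θ‖`. In the sparse regime take for `u`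
the norm of the hard-thresholded observations on the support of `θ`, which is within
`O(√s (1 + x))` of `‖θ‖`. On the support the correction by `α_s` costs a bias of at most
`s α_s = O(s x²)`; off the support it makes each summand of `Q̂` centred, and the choice of `x`
makes the total variance of these summands `O(s²)`.

Lower bound. The two fuzzy hypotheses are `θ = 0` and `θ` uniform over vectors with one spike of a
common height in each of `s` disjoint blocks of `⌊d / s⌋` coordinates. All the latter have the same
norm, and the second moment of the likelihood ratio of the mixture to the null is at most `e`.
-/

noncomputable section

open scoped ENNReal

namespace SparseNorm

section Integral

variable {Ω : Type*} [MeasurableSpace Ω] {μ : Measure Ω} {f g : Ω → ℝ}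

lemma lintegral_ofReal_le_ofReal_integral (hf : 0 ≤ f) (hfg : f ≤ g) (hg : Integrable g μ) :
    ∫⁻ ω, ENNReal.ofReal (f ω) ∂μ ≤ ENNReal.ofReal (∫ ω, g ω ∂μ) := by
  rw [ofReal_integral_eq_lintegral_ofReal hg (ae_of_all μ (hf.trans hfg))]
  exact lintegral_mono fun ω => ENNReal.ofReal_le_ofReal (hfg ω)

lemma integral_abs_le_sqrt_integral_sq [IsProbabilityMeasure μ] (hf : MemLp f 2 μ) :
    ∫ ω, |f ω| ∂μ ≤ √(∫ ω, f ω ^ 2 ∂μ) := by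
  have hvar := variance_nonneg |f| μ
  rw [variance_eq_sub hf.abs] at hvar
  simp only [Pi.pow_apply, Pi.abs_apply, sq_abs] at hvar
  exact Real.le_sqrt_of_sq_le (sub_nonneg.1 hvar)

lemma integral_sub_average_sq_le [IsFiniteMeasure μ] (hf : MemLp f 2 μ) (c : ℝ) :
    ∫ ω, (f ω - ⨍ ω', f ω' ∂μ) ^ 2 ∂μ ≤ ∫ ω, (f ω - c) ^ 2 ∂μ := by
  set a := ⨍ ω', f ω' ∂μ
  have hfa : MemLp (fun ω => f ω - a) 2 μ := hf.sub (memLp_const a)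
  have hcross : Integrable (fun ω => 2 * (a - c) * (f ω - a)) μ :=
    (hfa.integrable one_le_two).const_mul _
  have hrest : Integrable (fun ω => 2 * (a - c) * (f ω - a) + (a - c) ^ 2) μ :=
    hcross.add (integrable_const _)
  have hexpand : ∀ ω, (f ω - c) ^ 2 = (f ω - a) ^ 2 + (2 * (a - c) * (f ω - a) + (a - c) ^ 2) :=
    fun ω => by ring
  calc ∫ ω, (f ω - a) ^ 2 ∂μ ≤ ∫ ω, (f ω - a) ^ 2 ∂μ + μ.real Set.univ * (a - c) ^ 2 :=
        le_add_of_nonneg_right (by positivity)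
    _ = ∫ ω, (f ω - c) ^ 2 ∂μ := by
        simp_rw [hexpand]
        rw [integral_add hfa.integrable_sq hrest, integral_add hcross (integrable_const _),
          integral_const_mul, integral_sub_average, integral_const, mul_zero, zero_add,
          smul_eq_mul]

end Integral

section TwoHypotheses

lemma half_sq_mul_min_one_le {f : ℝ} (hf : 0 ≤ f) (g t₀ t₁ : ℝ) :
    (t₁ - t₀) ^ 2 / 2 * min 1 f ≤ (g - t₀) ^ 2 + f * (g - t₁) ^ 2 := by
  calc (t₁ - t₀) ^ 2 / 2 * min 1 f ≤ ((g - t₀) ^ 2 + (g - t₁) ^ 2) * min 1 f := by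
        gcongr
        nlinarith [sq_nonneg (2 * g - t₀ - t₁)]
    _ = min 1 f * (g - t₀) ^ 2 + min 1 f * (g - t₁) ^ 2 := by ring
    _ ≤ 1 * (g - t₀) ^ 2 + f * (g - t₁) ^ 2 := by
        gcongr
        exacts [min_le_left _ _, min_le_right _ _]
    _ = (g - t₀) ^ 2 + f * (g - t₁) ^ 2 := by rw [one_mul]

lemma sub_sq_div_four_le_min_one (f : ℝ) : f - f ^ 2 / 4 ≤ min 1 f :=
  le_min (by nlinarith [sq_nonneg (f / 2 - 1)]) (by nlinarith [sq_nonneg f])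

variable {Ω : Type*} [MeasurableSpace Ω] {P : Measure Ω} [IsProbabilityMeasure P] {f : Ω → ℝ}

lemma one_sub_integral_sq_div_four_le_integral_min (hf : MemLp f 2 P) (hf1 : ∫ ω, f ω ∂P = 1) :
    1 - (∫ ω, f ω ^ 2 ∂P) / 4 ≤ ∫ ω, min 1 (f ω) ∂P := by
  have hint : Integrable f P := hf.integrable one_le_two
  have hsq : Integrable (fun ω => f ω ^ 2 / 4) P := hf.integrable_sq.div_const 4
  calc 1 - (∫ ω, f ω ^ 2 ∂P) / 4 = ∫ ω, (f ω - f ω ^ 2 / 4) ∂P := by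
        rw [integral_sub hint hsq, hf1, integral_div]
    _ ≤ ∫ ω, min 1 (f ω) ∂P :=
        integral_mono (hint.sub hsq) ((integrable_const 1).inf hint)
          fun ω => sub_sq_div_four_le_min_one (f ω)

lemma ofReal_le_lintegral_add_lintegral_withDensity (hf0 : 0 ≤ f) (hf : MemLp f 2 P)
    (hf1 : ∫ ω, f ω ∂P = 1) {B : ℝ} (hB : ∫ ω, f ω ^ 2 ∂P ≤ B) {G : Ω → ℝ} (hG : Measurable G)
    (t₀ t₁ : ℝ) :
    ENNReal.ofReal ((t₁ - t₀) ^ 2 / 2 * (1 - B / 4)) ≤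
      ∫⁻ ω, ENNReal.ofReal ((G ω - t₀) ^ 2) ∂P +
        ∫⁻ ω, ENNReal.ofReal ((G ω - t₁) ^ 2)
          ∂(P.withDensity fun ω => ENNReal.ofReal (f ω)) := by
  have hmin : Integrable (fun ω => (t₁ - t₀) ^ 2 / 2 * min 1 (f ω)) P :=
    ((integrable_const 1).inf (hf.integrable one_le_two)).const_mul _
  have hmin0 : ∀ ω, 0 ≤ (t₁ - t₀) ^ 2 / 2 * min 1 (f ω) := fun ω =>
    mul_nonneg (by positivity) (le_min zero_le_one (hf0 ω))
  calc ENNReal.ofReal ((t₁ - t₀) ^ 2 / 2 * (1 - B / 4))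
      ≤ ENNReal.ofReal ((t₁ - t₀) ^ 2 / 2 * ∫ ω, min 1 (f ω) ∂P) := by
        gcongr
        linarith [one_sub_integral_sq_div_four_le_integral_min hf hf1]
    _ = ∫⁻ ω, ENNReal.ofReal ((t₁ - t₀) ^ 2 / 2 * min 1 (f ω)) ∂P := by
        rw [← integral_const_mul, ofReal_integral_eq_lintegral_ofReal hmin (ae_of_all P hmin0)]
    _ ≤ ∫⁻ ω, (ENNReal.ofReal ((G ω - t₀) ^ 2) +
          ENNReal.ofReal (f ω) * ENNReal.ofReal ((G ω - t₁) ^ 2)) ∂P := by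
        refine lintegral_mono fun ω => ?_
        rw [← ENNReal.ofReal_mul (hf0 ω), ← ENNReal.ofReal_add (sq_nonneg _)
          (mul_nonneg (hf0 ω) (sq_nonneg _))]
        exact ENNReal.ofReal_le_ofReal (half_sq_mul_min_one_le (hf0 ω) _ _ _)
    _ = _ := by
        rw [lintegral_add_left (by fun_prop), lintegral_withDensity_eq_lintegral_mul₀
          hf.1.aemeasurable.ennreal_ofReal (by fun_prop)]
        rfl

end TwoHypotheses

section GaussianShift

variable {ι : Type*} [Fintype ι]

lemma pi_withDensity_ofReal {X : ι → Type*} [∀ i, MeasurableSpace (X i)]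
    {μ : ∀ i, Measure (X i)} [∀ i, SigmaFinite (μ i)] {f : ∀ i, X i → ℝ}
    (hf0 : ∀ i, 0 ≤ f i) (hf : ∀ i, Integrable (f i) (μ i)) :
    Measure.pi (fun i => (μ i).withDensity fun x => ENNReal.ofReal (f i x)) =
      (Measure.pi μ).withDensity fun x => ENNReal.ofReal (∏ i, f i (x i)) := by
  have : ∀ i, IsFiniteMeasure ((μ i).withDensity fun x => ENNReal.ofReal (f i x)) := fun i =>
    isFiniteMeasure_withDensity_ofReal (hf i).2
  refine Measure.pi_eq fun A hA => ?_
  have hint : Integrable (fun x => ∏ i, f i (x i)) (Measure.pi fun i => (μ i).restrict (A i)) :=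
    Integrable.fintype_prod_dep fun i => (hf i).restrict
  calc ((Measure.pi μ).withDensity fun x => ENNReal.ofReal (∏ i, f i (x i))) (Set.univ.pi A)
      = ∫⁻ x, ENNReal.ofReal (∏ i, f i (x i)) ∂(Measure.pi fun i => (μ i).restrict (A i)) := by
        rw [withDensity_apply _ (MeasurableSet.univ_pi hA), Measure.restrict_pi_pi]
    _ = ENNReal.ofReal (∏ i, ∫ x in A i, f i x ∂(μ i)) := by
        rw [← ofReal_integral_eq_lintegral_ofReal hint
          (ae_of_all _ fun x => Finset.prod_nonneg fun i _ => hf0 i (x i)),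
          integral_fintype_prod_eq_prod]
    _ = ∏ i, ((μ i).withDensity fun x => ENNReal.ofReal (f i x)) (A i) := by
        rw [ENNReal.ofReal_prod_of_nonneg fun i _ => integral_nonneg (hf0 i)]
        refine Finset.prod_congr rfl fun i _ => ?_
        rw [withDensity_apply _ (hA i),
          ofReal_integral_eq_lintegral_ofReal (hf i).restrict (ae_of_all _ (hf0 i))]

lemma gaussianReal_eq_withDensity_exp (a : ℝ) :
    gaussianReal a 1 =
      (gaussianReal 0 1).withDensity fun x => ENNReal.ofReal (Real.exp (a * x - a * a / 2)) := by
  rw [gaussianReal_of_var_ne_zero a one_ne_zero, gaussianReal_of_var_ne_zero 0 one_ne_zero,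
    ← withDensity_mul _ (measurable_gaussianPDF 0 1) (by fun_prop)]
  congr 1
  ext x
  rw [Pi.mul_apply, gaussianPDF, gaussianPDF, ← ENNReal.ofReal_mul (gaussianPDFReal_nonneg 0 1 x),
    gaussianPDFReal, gaussianPDFReal, mul_assoc (√_)⁻¹, ← Real.exp_add]
  congr 3
  simp only [NNReal.coe_one]
  ring

/-- The law of a family of independent standard normal variables indexed by `ι`. -/
abbrev stdGaussianPi (ι : Type*) [Fintype ι] : Measure (ι → ℝ) :=
  Measure.pi fun _ : ι => gaussianReal 0 1

/-- The Cameron–Martin likelihood ratio at `ξ` of the standard Gaussian law translated by `u` to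
the standard Gaussian law. -/
def shiftDensity (u ξ : ι → ℝ) : ℝ :=
  Real.exp (u ⬝ᵥ ξ - u ⬝ᵥ u / 2)

lemma shiftDensity_nonneg (u : ι → ℝ) : 0 ≤ shiftDensity u := fun _ => (Real.exp_pos _).le

lemma shiftDensity_eq_prod (u ξ : ι → ℝ) :
    shiftDensity u ξ = ∏ i, Real.exp (u i * ξ i - u i * u i / 2) := by
  rw [shiftDensity, ← Real.exp_sum, Finset.sum_sub_distrib, ← Finset.sum_div]
  rfl

lemma shiftDensity_mul (u v ξ : ι → ℝ) :
    shiftDensity u ξ * shiftDensity v ξ = Real.exp (u ⬝ᵥ v) * shiftDensity (u + v) ξ := by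
  simp only [shiftDensity, ← Real.exp_add, add_dotProduct, dotProduct_add, dotProduct_comm v u]
  congr 1
  ring

lemma integrable_exp_mul_sub_gaussianReal (a b : ℝ) :
    Integrable (fun x => Real.exp (a * x - b)) (gaussianReal 0 1) := by
  simp only [Real.exp_sub]
  exact (integrable_exp_mul_gaussianReal a).div_const _

lemma integrable_shiftDensity (u : ι → ℝ) : Integrable (shiftDensity u) (stdGaussianPi ι) := by
  simp only [funext (shiftDensity_eq_prod u)]
  exact Integrable.fintype_prod fun i => integrable_exp_mul_sub_gaussianReal (u i) _

lemma map_add_stdGaussianPi (u : ι → ℝ) :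
    (stdGaussianPi ι).map (fun ξ => u + ξ) =
      (stdGaussianPi ι).withDensity fun ξ => ENNReal.ofReal (shiftDensity u ξ) := by
  calc (stdGaussianPi ι).map (fun ξ => u + ξ) = Measure.pi fun i => gaussianReal (u i) 1 := by
        change (stdGaussianPi ι).map (fun ξ i => u i + ξ i) = _
        rw [Measure.pi_map_pi (f := fun i x => u i + x) fun i => by fun_prop]
        simp only [gaussianReal_map_const_add, zero_add]
    _ = (stdGaussianPi ι).withDensity fun ξ => ENNReal.ofReal (shiftDensity u ξ) := by
        simp only [gaussianReal_eq_withDensity_exp (u _), shiftDensity_eq_prod]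
        exact pi_withDensity_ofReal (fun i x => (Real.exp_pos _).le)
          fun i => integrable_exp_mul_sub_gaussianReal (u i) _

lemma integral_shiftDensity (u : ι → ℝ) : ∫ ξ, shiftDensity u ξ ∂(stdGaussianPi ι) = 1 := by
  have hmass : ∫⁻ ξ, ENNReal.ofReal (shiftDensity u ξ) ∂(stdGaussianPi ι) = 1 := by
    rw [← setLIntegral_univ, ← withDensity_apply _ MeasurableSet.univ, ← map_add_stdGaussianPi,
      Measure.map_apply (by fun_prop) MeasurableSet.univ, Set.preimage_univ, measure_univ]
  rw [integral_eq_lintegral_of_nonneg_ae (ae_of_all _ (shiftDensity_nonneg u))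
    (integrable_shiftDensity u).1, hmass, ENNReal.toReal_one]

lemma integrable_shiftDensity_mul (u v : ι → ℝ) :
    Integrable (fun ξ => shiftDensity u ξ * shiftDensity v ξ) (stdGaussianPi ι) := by
  simp only [shiftDensity_mul]
  exact (integrable_shiftDensity _).const_mul _

lemma integral_shiftDensity_mul (u v : ι → ℝ) :
    ∫ ξ, shiftDensity u ξ * shiftDensity v ξ ∂(stdGaussianPi ι) = Real.exp (u ⬝ᵥ v) := by
  simp only [shiftDensity_mul]
  rw [integral_const_mul, integral_shiftDensity, mul_one]

lemma memLp_shiftDensity (u : ι → ℝ) : MemLp (shiftDensity u) 2 (stdGaussianPi ι) := by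
  rw [memLp_two_iff_integrable_sq (integrable_shiftDensity u).1]
  simpa only [sq] using integrable_shiftDensity_mul u u

end GaussianShift

section Mixture

variable {ι κ : Type*} [Fintype ι] [Fintype κ]

/-- The likelihood ratio of the uniform mixture of the standard Gaussian laws translated by the
vectors `u k`. -/
def mixtureDensity (u : κ → ι → ℝ) (ξ : ι → ℝ) : ℝ :=
  (Fintype.card κ : ℝ)⁻¹ * ∑ k, shiftDensity (u k) ξ

lemma mixtureDensity_nonneg (u : κ → ι → ℝ) : 0 ≤ mixtureDensity u := fun ξ =>
  mul_nonneg (by positivity) (Finset.sum_nonneg fun k _ => shiftDensity_nonneg (u k) ξ)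

lemma memLp_mixtureDensity (u : κ → ι → ℝ) : MemLp (mixtureDensity u) 2 (stdGaussianPi ι) :=
  (memLp_finsetSum _ fun k _ => memLp_shiftDensity (u k)).const_mul _

lemma integral_mixtureDensity [Nonempty κ] (u : κ → ι → ℝ) :
    ∫ ξ, mixtureDensity u ξ ∂(stdGaussianPi ι) = 1 := by
  simp only [mixtureDensity]
  rw [integral_const_mul, integral_finsetSum _ fun k _ => integrable_shiftDensity (u k)]
  simp only [integral_shiftDensity, Finset.sum_const, Finset.card_univ, nsmul_one]
  exact inv_mul_cancel₀ (Nat.cast_ne_zero.2 Fintype.card_ne_zero)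

lemma integral_mixtureDensity_sq (u : κ → ι → ℝ) :
    ∫ ξ, mixtureDensity u ξ ^ 2 ∂(stdGaussianPi ι) =
      (Fintype.card κ : ℝ)⁻¹ ^ 2 * ∑ k, ∑ k', Real.exp (u k ⬝ᵥ u k') := by
  have hint : ∀ k k', Integrable (fun ξ => shiftDensity (u k) ξ * shiftDensity (u k') ξ)
      (stdGaussianPi ι) := fun k k' => integrable_shiftDensity_mul _ _
  simp only [mixtureDensity, mul_pow, sq (∑ k, shiftDensity (u k) _), Finset.sum_mul_sum]
  rw [integral_const_mul,
    integral_finsetSum _ fun k _ => integrable_finsetSum _ fun k' _ => hint k k']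
  simp only [integral_finsetSum _ fun k' _ => hint _ k', integral_shiftDensity_mul]

lemma withDensity_mixtureDensity [Nonempty κ] (u : κ → ι → ℝ) :
    (stdGaussianPi ι).withDensity (fun ξ => ENNReal.ofReal (mixtureDensity u ξ)) =
      (Fintype.card κ : ℝ≥0∞)⁻¹ • ∑ k, (stdGaussianPi ι).map fun ξ => u k + ξ := by
  have hmeas : ∀ k, Measurable fun ξ => ENNReal.ofReal (shiftDensity (u k) ξ) := fun k => by
    simp only [shiftDensity, dotProduct]
    fun_prop
  have hdens : (fun ξ => ENNReal.ofReal (mixtureDensity u ξ)) =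
      (Fintype.card κ : ℝ≥0∞)⁻¹ • ∑' k, fun ξ => ENNReal.ofReal (shiftDensity (u k) ξ) := by
    ext ξ
    rw [mixtureDensity, ENNReal.ofReal_mul (by positivity), ENNReal.ofReal_inv_of_pos
      (Nat.cast_pos.2 Fintype.card_pos), ENNReal.ofReal_natCast,
      ENNReal.ofReal_sum_of_nonneg fun k _ => shiftDensity_nonneg (u k) ξ, Pi.smul_apply,
      smul_eq_mul, tsum_fintype, Finset.sum_apply]
  rw [hdens, withDensity_smul' _ _ (by simp [Fintype.card_ne_zero]), withDensity_tsum hmeas,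
    Measure.sum_fintype]
  simp only [map_add_stdGaussianPi]

lemma lintegral_withDensity_mixtureDensity_le [Nonempty κ] {u : κ → ι → ℝ}
    {F : (ι → ℝ) → ℝ≥0∞} (hF : Measurable F) {R : ℝ≥0∞}
    (hR : ∀ k, ∫⁻ ξ, F (u k + ξ) ∂(stdGaussianPi ι) ≤ R) :
    ∫⁻ ξ, F ξ ∂((stdGaussianPi ι).withDensity fun ξ => ENNReal.ofReal (mixtureDensity u ξ)) ≤
      R := by
  rw [withDensity_mixtureDensity, lintegral_smul_measure, lintegral_finsetSum_measure, smul_eq_mul]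
  calc (Fintype.card κ : ℝ≥0∞)⁻¹ * ∑ k, ∫⁻ ξ, F ξ ∂((stdGaussianPi ι).map fun ξ => u k + ξ)
      ≤ (Fintype.card κ : ℝ≥0∞)⁻¹ * ∑ _k : κ, R := by
        gcongr with k
        rw [lintegral_map hF (by fun_prop)]
        exact hR k
    _ = R := by
        rw [Finset.sum_const, Finset.card_univ, nsmul_eq_mul, ← mul_assoc,
          ENNReal.inv_mul_cancel (Nat.cast_ne_zero.2 Fintype.card_ne_zero)
            (ENNReal.natCast_ne_top _), one_mul]

lemma ofReal_le_of_forall_lintegral_le [Nonempty κ] {u : κ → ι → ℝ} {B : ℝ}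
    (hB : ∑ k, ∑ k', Real.exp (u k ⬝ᵥ u k') ≤ B * (Fintype.card κ : ℝ) ^ 2)
    {G : (ι → ℝ) → ℝ} (hG : Measurable G) {t₀ t₁ : ℝ} {R : ℝ≥0∞}
    (h₀ : ∫⁻ ξ, ENNReal.ofReal ((G ξ - t₀) ^ 2) ∂(stdGaussianPi ι) ≤ R)
    (h₁ : ∀ k, ∫⁻ ξ, ENNReal.ofReal ((G (u k + ξ) - t₁) ^ 2) ∂(stdGaussianPi ι) ≤ R) :
    ENNReal.ofReal ((1 - B / 4) / 4 * (t₁ - t₀) ^ 2) ≤ R := by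
  have hsecond : ∫ ξ, mixtureDensity u ξ ^ 2 ∂(stdGaussianPi ι) ≤ B := by
    rw [integral_mixtureDensity_sq, inv_pow,
      inv_mul_le_iff₀ (pow_pos (Nat.cast_pos.2 Fintype.card_pos) 2), mul_comm]
    exact hB
  have hsum : ENNReal.ofReal ((t₁ - t₀) ^ 2 / 2 * (1 - B / 4)) ≤ R + R :=
    (ofReal_le_lintegral_add_lintegral_withDensity (mixtureDensity_nonneg u)
      (memLp_mixtureDensity u) (integral_mixtureDensity u) hsecond hG t₀ t₁).trans
      (add_le_add h₀ (lintegral_withDensity_mixtureDensity_le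
        (F := fun ξ => ENNReal.ofReal ((G ξ - t₁) ^ 2)) (by fun_prop) h₁))
  calc ENNReal.ofReal ((1 - B / 4) / 4 * (t₁ - t₀) ^ 2)
      = 2⁻¹ * ENNReal.ofReal ((t₁ - t₀) ^ 2 / 2 * (1 - B / 4)) := by
        rw [← ENNReal.ofReal_ofNat, ← ENNReal.ofReal_inv_of_pos two_pos,
          ← ENNReal.ofReal_mul (by norm_num)]
        congr 1
        ring
    _ ≤ 2⁻¹ * (R + R) := by gcongr
    _ = R := by rw [← two_mul, ← mul_assoc, ENNReal.inv_mul_cancel two_ne_zero (by simp), one_mul]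

end Mixture

section Risk

variable {s d : ℕ} {σ : ℝ}

lemma lintegral_obsLaw (θ : EuclideanSpace ℝ (Fin d)) (σ : ℝ) {F : (Fin d → ℝ) → ℝ≥0∞}
    (hF : Measurable F) :
    ∫⁻ y, F y ∂(obsLaw θ σ) = ∫⁻ ξ, F (θ.ofLp + σ • ξ) ∂(stdGaussianPi (Fin d)) :=
  lintegral_map hF (by fun_prop)

lemma maxRisk_one (Θ : Set (EuclideanSpace ℝ (Fin d))) (T : EuclideanSpace ℝ (Fin d) → ℝ)
    {G : (Fin d → ℝ) → ℝ} (hG : Measurable G) :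
    maxRisk 1 Θ T G = ⨆ θ ∈ Θ, ∫⁻ ξ, ENNReal.ofReal ((G (θ.ofLp + ξ) - T θ) ^ 2)
      ∂(stdGaussianPi (Fin d)) := by
  refine iSup_congr fun θ => iSup_congr fun _ => ?_
  rw [lintegral_obsLaw θ 1 (by fun_prop)]
  simp only [one_smul]

lemma maxRisk_mono {Θ Θ' : Set (EuclideanSpace ℝ (Fin d))} (h : Θ ⊆ Θ')
    (T : EuclideanSpace ℝ (Fin d) → ℝ) (G : (Fin d → ℝ) → ℝ) :
    maxRisk σ Θ T G ≤ maxRisk σ Θ' T G :=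
  biSup_mono h

lemma lintegral_obsLaw_smul (hσ : 0 < σ) (η : EuclideanSpace ℝ (Fin d)) {G : (Fin d → ℝ) → ℝ}
    (hG : Measurable G) :
    ∫⁻ y, ENNReal.ofReal ((G y - ‖σ • η‖) ^ 2) ∂(obsLaw (σ • η) σ) =
      ENNReal.ofReal (σ ^ 2) *
        ∫⁻ z, ENNReal.ofReal ((σ⁻¹ * G (σ • z) - ‖η‖) ^ 2) ∂(obsLaw η 1) := by
  rw [lintegral_obsLaw _ _ (by fun_prop), lintegral_obsLaw _ _ (by fun_prop),
    ← lintegral_const_mul _ (by fun_prop)]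
  refine lintegral_congr fun ξ => ?_
  rw [← ENNReal.ofReal_mul (sq_nonneg σ), ← mul_pow, norm_smul, Real.norm_of_nonneg hσ.le,
    one_smul, smul_add, mul_sub, mul_inv_cancel_left₀ hσ.ne', WithLp.ofLp_smul]

lemma maxRisk_norm_eq_mul {Θ : Set (EuclideanSpace ℝ (Fin d))}
    (hΘ : ∀ c : ℝ, ∀ θ ∈ Θ, c • θ ∈ Θ) (hσ : 0 < σ) {G : (Fin d → ℝ) → ℝ} (hG : Measurable G) :
    maxRisk σ Θ (fun θ => ‖θ‖) G =
      ENNReal.ofReal (σ ^ 2) * maxRisk 1 Θ (fun θ => ‖θ‖) (fun z => σ⁻¹ * G (σ • z)) := by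
  simp only [maxRisk, ENNReal.mul_iSup, ← lintegral_obsLaw_smul hσ _ hG]
  refine le_antisymm (iSup₂_le fun θ hθ => ?_) (iSup₂_le fun η hη => ?_)
  · refine le_iSup₂_of_le (σ⁻¹ • θ) (hΘ σ⁻¹ θ hθ) ?_
    rw [smul_inv_smul₀ hσ.ne']
  · exact le_iSup₂_of_le (σ • η) (hΘ σ η hη) le_rfl

lemma zero_mem_sparseClass (s d : ℕ) : 0 ∈ sparseClass s d :=
  hammingNorm_zero.trans_le s.zero_le

lemma smul_mem_sparseClass (c : ℝ) (θ : EuclideanSpace ℝ (Fin d)) (hθ : θ ∈ sparseClass s d) :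
    c • θ ∈ sparseClass s d :=
  (hammingNorm_smul_le_hammingNorm (k := c) (x := θ.ofLp)).trans hθ

lemma sparseClass_mono {s' : ℕ} (h : s ≤ s') : sparseClass s d ⊆ sparseClass s' d :=
  fun _ hθ => le_trans hθ h

lemma normRate_eq_mul (s d : ℕ) (σ : ℝ) : normRate s d σ = σ ^ 2 * normRate s d 1 := by
  unfold normRate
  split_ifs <;> ring

end Risk

section LowerBound

lemma ofReal_le_maxRisk_one {d : ℕ} {κ : Type*} [Fintype κ] [Nonempty κ]
    {Θ : Set (EuclideanSpace ℝ (Fin d))} (hΘ : 0 ∈ Θ) {u : κ → Fin d → ℝ}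
    (hu : ∀ k, WithLp.toLp 2 (u k) ∈ Θ) {T : EuclideanSpace ℝ (Fin d) → ℝ} {t : ℝ}
    (hT : ∀ k, T (WithLp.toLp 2 (u k)) = t) {B : ℝ}
    (hB : ∑ k, ∑ k', Real.exp (u k ⬝ᵥ u k') ≤ B * (Fintype.card κ : ℝ) ^ 2)
    {G : (Fin d → ℝ) → ℝ} (hG : Measurable G) :
    ENNReal.ofReal ((1 - B / 4) / 4 * (t - T 0) ^ 2) ≤ maxRisk 1 Θ T G := by
  rw [maxRisk_one Θ T hG]
  refine ofReal_le_of_forall_lintegral_le hB hG (le_iSup₂_of_le 0 hΘ ?_) fun k =>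
    le_iSup₂_of_le (WithLp.toLp 2 (u k)) (hu k) ?_
  · simp only [WithLp.ofLp_zero, zero_add, le_refl]
  · simp only [hT, le_refl]

variable {I L ι : Type*} [Fintype I]

/-- The sum over `i` of the vectors with single non-zero entry `a` at position `p i`. -/
def spikes [DecidableEq ι] (a : ℝ) (p : I → ι) : ι → ℝ :=
  ∑ i, Pi.single (p i) a

lemma hammingNorm_spikes_le [Fintype ι] [DecidableEq ι] (a : ℝ) (p : I → ι) :
    hammingNorm (spikes a p) ≤ Fintype.card I := by
  refine (Finset.card_le_card (t := Finset.univ.image p) fun j hj => ?_).trans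
    Finset.card_image_le
  simp only [Finset.mem_filter, Finset.mem_univ, true_and, spikes, Finset.sum_apply] at hj
  obtain ⟨i, -, hi⟩ := Finset.exists_ne_zero_of_sum_ne_zero hj
  by_contra hnot
  have hne : j ≠ p i := fun h => hnot (h ▸ Finset.mem_image_of_mem p (Finset.mem_univ i))
  exact hi (by rw [Pi.single_apply, if_neg hne])

lemma spikes_dotProduct_spikes [Fintype ι] [DecidableEq ι] [DecidableEq L] (e : I × L ↪ ι)
    (a : ℝ) (k k' : I → L) :
    spikes a (fun i => e (i, k i)) ⬝ᵥ spikes a (fun i => e (i, k' i)) =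
      ∑ i, if k' i = k i then a * a else 0 := by
  classical
  rw [spikes, sum_dotProduct]
  refine Finset.sum_congr rfl fun i _ => ?_
  rw [single_dotProduct, spikes, Finset.sum_apply, Finset.sum_eq_single i]
  · simp only [Pi.single_apply, EmbeddingLike.apply_eq_iff_eq, Prod.mk.injEq, true_and, mul_ite,
      mul_zero, eq_comm]
  · intro b _ hb
    have hne : e (i, k i) ≠ e (b, k' b) := fun h => hb (congrArg Prod.fst (e.injective h)).symm
    rw [Pi.single_apply, if_neg hne]
  · exact fun h => absurd (Finset.mem_univ i) h

lemma norm_spikes [Fintype ι] [DecidableEq ι] (e : I × L ↪ ι) (a : ℝ) (k : I → L) :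
    ‖(WithLp.toLp 2 (spikes a fun i => e (i, k i)) : EuclideanSpace ℝ ι)‖ =
      √(Fintype.card I * (a * a)) := by
  classical
  rw [EuclideanSpace.norm_eq]
  simp only [Real.norm_eq_abs, abs_mul_abs_self, sq]
  rw [← dotProduct, spikes_dotProduct_spikes]
  simp only [if_true, Finset.sum_const, Finset.card_univ, nsmul_eq_mul]

lemma sum_prod_ite_eq [Fintype L] [DecidableEq I] [DecidableEq L] {R : Type*} [CommRing R]
    (c : R) (k : I → L) :
    ∑ k' : I → L, ∏ i, (if k' i = k i then c else 1) =
      (Fintype.card L - 1 + c) ^ Fintype.card I := by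
  have hrow : ∀ i, ∑ l, (if l = k i then c else 1) = (Fintype.card L : R) - 1 + c := fun i => by
    rw [← Finset.add_sum_erase _ _ (Finset.mem_univ (k i)), if_pos rfl,
      Finset.sum_congr rfl fun l hl => if_neg (Finset.ne_of_mem_erase hl), Finset.sum_const,
      nsmul_one, Finset.cast_card_erase_of_mem (Finset.mem_univ _), Finset.card_univ, add_comm]
  rw [← Fintype.prod_sum fun i l => if l = k i then c else (1 : R)]
  simp only [hrow, Finset.prod_const, Finset.card_univ]

lemma sum_exp_spikes_dotProduct_spikes [Fintype L] [Fintype ι] [DecidableEq I] [DecidableEq ι]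
    (e : I × L ↪ ι) (a : ℝ) :
    ∑ k : I → L, ∑ k' : I → L,
        Real.exp (spikes a (fun i => e (i, k i)) ⬝ᵥ spikes a (fun i => e (i, k' i))) =
      Fintype.card (I → L) * (Fintype.card L - 1 + Real.exp (a * a)) ^ Fintype.card I := by
  classical
  simp only [spikes_dotProduct_spikes, Real.exp_sum, apply_ite Real.exp, Real.exp_zero,
    sum_prod_ite_eq, Finset.sum_const, Finset.card_univ, nsmul_eq_mul]

lemma sum_exp_spikes_dotProduct_spikes_le [Fintype L] [Fintype ι] [DecidableEq I]
    [DecidableEq ι] [Nonempty L] (e : I × L ↪ ι) {a : ℝ}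
    (ha : Real.exp (a * a) ≤ 1 + (Fintype.card L : ℝ) / Fintype.card I) :
    ∑ k : I → L, ∑ k' : I → L,
        Real.exp (spikes a (fun i => e (i, k i)) ⬝ᵥ spikes a (fun i => e (i, k' i))) ≤
      Real.exp 1 * (Fintype.card (I → L) : ℝ) ^ 2 := by
  have hL : (0 : ℝ) ≤ Fintype.card L - 1 := sub_nonneg.2 (Nat.one_le_cast.2 Fintype.card_pos)
  rw [sum_exp_spikes_dotProduct_spikes]
  calc (Fintype.card (I → L) : ℝ) * (Fintype.card L - 1 + Real.exp (a * a)) ^ Fintype.card I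
      ≤ Fintype.card (I → L) *
          (Fintype.card L * (1 + (Fintype.card I : ℝ)⁻¹)) ^ Fintype.card I := by
        gcongr
        exact (add_le_add_right ha _).trans_eq (by ring)
    _ = (1 + (Fintype.card I : ℝ)⁻¹) ^ Fintype.card I * (Fintype.card (I → L) : ℝ) ^ 2 := by
        rw [mul_pow, Fintype.card_fun, Nat.cast_pow]
        ring
    _ ≤ Real.exp 1 * (Fintype.card (I → L) : ℝ) ^ 2 := by
        gcongr
        exact Real.one_add_inv_pow_le_exp

lemma log_one_add_nonneg {u : ℝ} (hu : 0 ≤ u) : 0 ≤ Real.log (1 + u) :=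
  Real.log_nonneg (le_add_of_nonneg_right hu)

variable {s m d : ℕ} {G : (Fin d → ℝ) → ℝ}

/- The height `a` of the spikes is chosen so that `exp (a²) = 1 + m / s`; the second moment of the
likelihood ratio is then `(1 + 1 / s) ^ s ≤ e`. -/
lemma ofReal_block_rate_le_maxRisk (hs : 1 ≤ s) (hm : 1 ≤ m) (hsm : s * m ≤ d)
    (hG : Measurable G) :
    ENNReal.ofReal (s * Real.log (1 + (m : ℝ) / s) / 16) ≤
      maxRisk 1 (sparseClass s d) (fun θ => ‖θ‖) G := by
  have hs0 : (0 : ℝ) < s := Nat.cast_pos.2 hs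
  have hlog : 0 ≤ Real.log (1 + (m : ℝ) / s) := log_one_add_nonneg (by positivity)
  obtain ⟨a, ha⟩ : ∃ a : ℝ, a * a = Real.log (1 + (m : ℝ) / s) :=
    ⟨√(Real.log (1 + (m : ℝ) / s)), Real.mul_self_sqrt hlog⟩
  have hexp : Real.exp (a * a) = 1 + (m : ℝ) / s := by rw [ha, Real.exp_log (by positivity)]
  obtain ⟨e⟩ : Nonempty (Fin s × Fin m ↪ Fin d) :=
    Function.Embedding.nonempty_of_card_le (by simpa using hsm)
  have : Nonempty (Fin m) := ⟨⟨0, hm⟩⟩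
  have hsparse : ∀ k : Fin s → Fin m,
      WithLp.toLp 2 (spikes a fun i => e (i, k i)) ∈ sparseClass s d := fun k =>
    (hammingNorm_spikes_le a _).trans (Fintype.card_fin s).le
  have hnorm : ∀ k : Fin s → Fin m,
      ‖(WithLp.toLp 2 (spikes a fun i => e (i, k i)) : EuclideanSpace ℝ (Fin d))‖ =
        √(s * (a * a)) := fun k => by rw [norm_spikes, Fintype.card_fin]
  have hchi := sum_exp_spikes_dotProduct_spikes_le e
    (a := a) (by simpa only [Fintype.card_fin] using hexp.le)
  refine le_trans (ENNReal.ofReal_le_ofReal ?_)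
    (ofReal_le_maxRisk_one (zero_mem_sparseClass s d) hsparse hnorm hchi hG)
  rw [norm_zero, sub_zero, Real.sq_sqrt (mul_nonneg hs0.le (mul_self_nonneg a)), ha]
  nlinarith [Real.exp_one_lt_three, mul_nonneg hs0.le hlog]

lemma log_one_add_le_two_mul_log_one_add {u v : ℝ} (hu : 0 ≤ u) (h : u ≤ 2 * v) :
    Real.log (1 + u) ≤ 2 * Real.log (1 + v) := by
  calc Real.log (1 + u) ≤ Real.log ((1 + v) ^ 2) :=
        Real.log_le_log (by linarith) (by nlinarith [sq_nonneg v])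
    _ = 2 * Real.log (1 + v) := by rw [Real.log_pow, Nat.cast_ofNat]

lemma natCast_le_two_mul_div_mul (hs : 1 ≤ s) (hsd : s ≤ d) :
    (d : ℝ) ≤ 2 * ((d / s : ℕ) * s) := by
  have hmod := Nat.mod_add_div d s
  have hlt := Nat.mod_lt d hs
  have hle : s ≤ s * (d / s) := Nat.le_mul_of_pos_right s ((Nat.one_le_div_iff hs).2 hsd)
  have : d ≤ 2 * (d / s * s) := by
    rw [mul_comm (d / s) s]
    omega
  exact_mod_cast this

lemma ofReal_sparse_rate_le_maxRisk (hs : 1 ≤ s) (hsd : s ≤ d) (hG : Measurable G) :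
    ENNReal.ofReal (s * Real.log (1 + (d : ℝ) / s ^ 2) / 32) ≤
      maxRisk 1 (sparseClass s d) (fun θ => ‖θ‖) G := by
  have hs0 : (0 : ℝ) < s := Nat.cast_pos.2 hs
  refine le_trans (ENNReal.ofReal_le_ofReal ?_) (ofReal_block_rate_le_maxRisk hs
    ((Nat.one_le_div_iff hs).2 hsd) (Nat.mul_div_le d s) hG)
  have hratio : (d : ℝ) / s ^ 2 ≤ 2 * (((d / s : ℕ) : ℝ) / s) := by
    rw [div_le_iff₀ (by positivity)]
    calc (d : ℝ) ≤ 2 * ((d / s : ℕ) * s) := natCast_le_two_mul_div_mul hs hsd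
      _ = 2 * (((d / s : ℕ) : ℝ) / s) * s ^ 2 := by field_simp
  have hlog := log_one_add_le_two_mul_log_one_add (by positivity) hratio
  linarith [mul_le_mul_of_nonneg_left hlog hs0.le]

lemma half_le_log_one_add {u : ℝ} (hu : 1 ≤ u) : 1 / 2 ≤ Real.log (1 + u) := by
  linarith [Real.log_two_gt_d9, Real.log_le_log two_pos (show 2 ≤ 1 + u by linarith)]

/- In the dense regime the sparse bound is applied at the sparsity level `⌊√d⌋ ≤ s`. -/
lemma ofReal_sqrt_le_maxRisk (hd : 1 ≤ d) (h : √(d : ℝ) ≤ s) (hG : Measurable G) :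
    ENNReal.ofReal (√(d : ℝ) / 128) ≤ maxRisk 1 (sparseClass s d) (fun θ => ‖θ‖) G := by
  have hq : 1 ≤ Nat.sqrt d := Nat.sqrt_pos.2 hd
  have hq1 : (1 : ℝ) ≤ Nat.sqrt d := Nat.one_le_cast.2 hq
  have hqd : (Nat.sqrt d : ℝ) ^ 2 ≤ d := by exact_mod_cast Nat.sqrt_le' d
  have hdq : (d : ℝ) ≤ (Nat.sqrt d + 1) ^ 2 := by exact_mod_cast (Nat.lt_succ_sqrt' d).le
  have hqs : Nat.sqrt d ≤ s := by exact_mod_cast (Real.le_sqrt_of_sq_le hqd).trans h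
  refine (ENNReal.ofReal_le_ofReal ?_).trans
    ((ofReal_sparse_rate_le_maxRisk hq (Nat.sqrt_le_self d) hG).trans
      (maxRisk_mono (sparseClass_mono hqs) _ _))
  have hlog : 1 / 2 ≤ Real.log (1 + (d : ℝ) / (Nat.sqrt d : ℝ) ^ 2) :=
    half_le_log_one_add ((one_le_div (by positivity)).2 hqd)
  have hsqrt : √(d : ℝ) ≤ 2 * Nat.sqrt d :=
    Real.sqrt_le_iff.2 ⟨by positivity, hdq.trans (by gcongr; linarith)⟩
  linarith [mul_le_mul_of_nonneg_left hlog (zero_le_one.trans hq1)]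

lemma ofReal_normRate_le_maxRisk_one (hs : 1 ≤ s) (hsd : s ≤ d) (hG : Measurable G) :
    ENNReal.ofReal (1 / 128 * normRate s d 1) ≤
      maxRisk 1 (sparseClass s d) (fun θ => ‖θ‖) G := by
  rw [normRate, one_pow, one_mul, one_mul]
  split_ifs with h
  · refine le_trans (ENNReal.ofReal_le_ofReal ?_) (ofReal_sparse_rate_le_maxRisk hs hsd hG)
    have hlog : 0 ≤ Real.log (1 + (d : ℝ) / s ^ 2) := log_one_add_nonneg (by positivity)
    linarith [mul_nonneg (Nat.cast_nonneg (α := ℝ) s) hlog]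
  · rw [one_div_mul_eq_div]
    exact ofReal_sqrt_le_maxRisk (hs.trans hsd) (not_lt.1 h) hG

lemma ofReal_normRate_le_minimaxRisk (hs : 1 ≤ s) (hsd : s ≤ d) {σ : ℝ} (hσ : 0 < σ) :
    ENNReal.ofReal (1 / 128 * normRate s d σ) ≤
      minimaxRisk σ (sparseClass s d) (fun θ => ‖θ‖) := by
  refine le_iInf₂ fun G hG => ?_
  rw [maxRisk_norm_eq_mul smul_mem_sparseClass hσ hG, normRate_eq_mul, mul_left_comm,
    ENNReal.ofReal_mul (sq_nonneg σ)]
  gcongr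
  exact ofReal_normRate_le_maxRisk_one hs hsd (by fun_prop)

end LowerBound

section Gaussian

lemma integrable_pow_gaussianReal (n : ℕ) : Integrable (fun t : ℝ => t ^ n) (gaussianReal 0 1) := by
  refine (memLp_id_gaussianReal n).integrable_norm_pow'.mono' (by fun_prop)
    (ae_of_all _ fun t => ?_)
  rw [norm_pow, id_eq]

lemma memLp_sq_gaussianReal : MemLp (fun t : ℝ => t ^ 2) 2 (gaussianReal 0 1) := by
  rw [memLp_two_iff_integrable_sq (by fun_prop)]
  simpa only [← pow_mul] using integrable_pow_gaussianReal 4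

lemma memLp_sq_sub_const_gaussianReal (c : ℝ) :
    MemLp (fun t : ℝ => t ^ 2 - c) 2 (gaussianReal 0 1) :=
  memLp_sq_gaussianReal.sub (memLp_const c)

lemma integral_sq_gaussianReal : ∫ t, t ^ 2 ∂(gaussianReal 0 1) = 1 := by
  have hvar := variance_fun_id_gaussianReal (μ := 0) (v := 1)
  rwa [variance_of_integral_eq_zero (by fun_prop) integral_id_gaussianReal] at hvar

lemma measurableSet_lt_abs (x : ℝ) : MeasurableSet {t : ℝ | x < |t|} :=
  measurableSet_lt measurable_const (by fun_prop)

lemma gaussianPDFReal_zero_one (t : ℝ) :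
    gaussianPDFReal 0 1 t = (√(2 * Real.pi))⁻¹ * Real.exp (-t ^ 2 / 2) := by
  simp only [gaussianPDFReal, NNReal.coe_one, mul_one, sub_zero]

lemma exp_neg_sub_sq_div_four (m t : ℝ) :
    Real.exp (-(t - m) ^ 2 / 4) = √(2 * Real.pi * 2) * gaussianPDFReal m 2 t := by
  rw [gaussianPDFReal, NNReal.coe_ofNat, mul_inv_cancel_left₀ (by positivity)]
  norm_num

lemma sq_le_mul_exp_div_four {w : ℝ} (hw : 0 ≤ w) : w ^ 2 ≤ 32 * Real.exp (w / 4) := by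
  nlinarith [Real.quadratic_le_exp_of_nonneg (x := w / 4) (by positivity)]

lemma exp_neg_abs_sub_sq_le (x t : ℝ) :
    Real.exp (-(|t| - x) ^ 2 / 4) ≤
      Real.exp (-(t - x) ^ 2 / 4) + Real.exp (-(t - -x) ^ 2 / 4) := by
  rcases abs_cases t with ⟨ht, -⟩ | ⟨ht, -⟩
  · rw [ht]
    exact le_add_of_nonneg_right (Real.exp_pos _).le
  · rw [ht, show (-t - x) ^ 2 = (t - -x) ^ 2 by ring]
    exact le_add_of_nonneg_left (Real.exp_pos _).le

/- With `w = t² - x² ≥ (|t| - x)²`, one has `w² e^(-t²/2) ≤ 32 e^(-x²/2) e^(-w/4)`, and `e^(-w/4)`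
is dominated by Gaussian densities of variance `2`. -/
lemma sq_sub_sq_sq_mul_gaussianPDFReal_le {x t : ℝ} (hx : 0 ≤ x) (ht : x < |t|) :
    (t ^ 2 - x ^ 2) ^ 2 * gaussianPDFReal 0 1 t ≤
      32 * √2 * Real.exp (-x ^ 2 / 2) * (gaussianPDFReal x 2 t + gaussianPDFReal (-x) 2 t) := by
  have hw : (|t| - x) ^ 2 ≤ t ^ 2 - x ^ 2 := by
    rw [← sq_abs t]
    nlinarith
  have hexp : Real.exp ((t ^ 2 - x ^ 2) / 4) * Real.exp (-t ^ 2 / 2) ≤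
      Real.exp (-x ^ 2 / 2) * Real.exp (-(|t| - x) ^ 2 / 4) := by
    rw [← Real.exp_add, ← Real.exp_add]
    exact Real.exp_le_exp.2 (by linarith)
  calc (t ^ 2 - x ^ 2) ^ 2 * gaussianPDFReal 0 1 t
      ≤ 32 * Real.exp ((t ^ 2 - x ^ 2) / 4) * gaussianPDFReal 0 1 t := by
        gcongr
        · exact gaussianPDFReal_nonneg 0 1 t
        · exact sq_le_mul_exp_div_four ((sq_nonneg _).trans hw)
    _ = 32 * (√(2 * Real.pi))⁻¹ *
          (Real.exp ((t ^ 2 - x ^ 2) / 4) * Real.exp (-t ^ 2 / 2)) := by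
        rw [gaussianPDFReal_zero_one]
        ring
    _ ≤ 32 * (√(2 * Real.pi))⁻¹ * (Real.exp (-x ^ 2 / 2) *
          (Real.exp (-(t - x) ^ 2 / 4) + Real.exp (-(t - -x) ^ 2 / 4))) := by
        refine mul_le_mul_of_nonneg_left (hexp.trans ?_) (by positivity)
        exact mul_le_mul_of_nonneg_left (exp_neg_abs_sub_sq_le x t) (Real.exp_pos _).le
    _ = 32 * √2 * Real.exp (-x ^ 2 / 2) *
          (gaussianPDFReal x 2 t + gaussianPDFReal (-x) 2 t) := by
        rw [exp_neg_sub_sq_div_four, exp_neg_sub_sq_div_four, Real.sqrt_mul (by positivity) 2]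
        field_simp

lemma setIntegral_sq_sub_sq_sq_le {x : ℝ} (hx : 0 ≤ x) :
    ∫ t in {t : ℝ | x < |t|}, (t ^ 2 - x ^ 2) ^ 2 ∂(gaussianReal 0 1) ≤
      96 * Real.exp (-x ^ 2 / 2) := by
  have hbound : ∀ t, gaussianPDFReal 0 1 t •
      ({t : ℝ | x < |t|}.indicator (fun t => (t ^ 2 - x ^ 2) ^ 2) t) ≤
      32 * √2 * Real.exp (-x ^ 2 / 2) * (gaussianPDFReal x 2 t + gaussianPDFReal (-x) 2 t) := by
    intro t
    rw [smul_eq_mul, mul_comm, Set.indicator_apply, ite_mul, zero_mul]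
    split_ifs with ht
    · exact sq_sub_sq_sq_mul_gaussianPDFReal_le hx ht
    · have := gaussianPDFReal_nonneg x 2 t
      have := gaussianPDFReal_nonneg (-x) 2 t
      positivity
  have hnonneg : ∀ t, 0 ≤ gaussianPDFReal 0 1 t •
      ({t : ℝ | x < |t|}.indicator (fun t => (t ^ 2 - x ^ 2) ^ 2) t) := fun t =>
    mul_nonneg (gaussianPDFReal_nonneg _ _ _) (Set.indicator_nonneg (fun _ _ => sq_nonneg _) _)
  have hint := integrable_gaussianPDFReal x 2
  have hint' := integrable_gaussianPDFReal (-x) 2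
  calc ∫ t in {t : ℝ | x < |t|}, (t ^ 2 - x ^ 2) ^ 2 ∂(gaussianReal 0 1)
      ≤ ∫ t, 32 * √2 * Real.exp (-x ^ 2 / 2) *
          (gaussianPDFReal x 2 t + gaussianPDFReal (-x) 2 t) := by
        rw [← integral_indicator (measurableSet_lt_abs x),
          integral_gaussianReal_eq_integral_smul one_ne_zero]
        exact integral_mono_of_nonneg (ae_of_all _ hnonneg) ((hint.add hint').const_mul _)
          (ae_of_all _ hbound)
    _ = 32 * √2 * Real.exp (-x ^ 2 / 2) * 2 := by
        rw [integral_const_mul, integral_add hint hint', integral_gaussianPDFReal_eq_one _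
          two_ne_zero, integral_gaussianPDFReal_eq_one _ two_ne_zero, one_add_one_eq_two]
    _ ≤ 32 * (3 / 2) * Real.exp (-x ^ 2 / 2) * 2 := by
        gcongr
        exact Real.sqrt_le_iff.2 ⟨by norm_num, by norm_num⟩
    _ = 96 * Real.exp (-x ^ 2 / 2) := by ring

lemma integral_sq_sub_one_sq_le : ∫ t, (t ^ 2 - 1) ^ 2 ∂(gaussianReal 0 1) ≤ 96 := by
  calc ∫ t, (t ^ 2 - 1) ^ 2 ∂(gaussianReal 0 1) ≤ ∫ t, (t ^ 2 - 0) ^ 2 ∂(gaussianReal 0 1) := by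
        have haverage := integral_sub_average_sq_le memLp_sq_gaussianReal 0
        rwa [average_eq_integral, integral_sq_gaussianReal] at haverage
    _ = ∫ t in {t : ℝ | 0 < |t|}, (t ^ 2 - 0 ^ 2) ^ 2 ∂(gaussianReal 0 1) := by
        rw [zero_pow two_ne_zero]
        refine (setIntegral_eq_integral_of_forall_compl_eq_zero fun t ht => ?_).symm
        have ht0 : t = 0 := not_ne_iff.1 (mt abs_pos.2 ht)
        rw [ht0, zero_pow two_ne_zero, sub_zero, zero_pow two_ne_zero]
    _ ≤ 96 * Real.exp (-0 ^ 2 / 2) := setIntegral_sq_sub_sq_sq_le le_rfl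
    _ = 96 := by norm_num

lemma exp_neg_sq_half_div_le_gaussianPDFReal {x t : ℝ} (hx : 1 ≤ x)
    (ht : t ∈ Set.Ioc x (x + x⁻¹)) :
    Real.exp (-x ^ 2 / 2) / 27 ≤ gaussianPDFReal 0 1 t := by
  have hx0 : 0 < x := zero_lt_one.trans_le hx
  have hinv : x⁻¹ ^ 2 ≤ 1 := pow_le_one₀ (inv_nonneg.2 hx0.le) (inv_le_one_of_one_le₀ hx)
  have hsq : t ^ 2 ≤ x ^ 2 + 3 := by
    calc t ^ 2 ≤ (x + x⁻¹) ^ 2 := pow_le_pow_left₀ (hx0.trans ht.1).le ht.2 2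
      _ = x ^ 2 + 2 + x⁻¹ ^ 2 := by field_simp; ring
      _ ≤ x ^ 2 + 3 := by linarith
  have hexp : (1 : ℝ) / 9 ≤ Real.exp (-2) := by
    rw [one_div, Real.exp_neg]
    gcongr
    calc Real.exp 2 = Real.exp 1 ^ 2 := by rw [← Real.exp_nat_mul]; norm_num
      _ ≤ 3 ^ 2 := by gcongr; exact Real.exp_one_lt_three.le
      _ = 9 := by norm_num
  have hpi : (1 : ℝ) / 3 ≤ (√(2 * Real.pi))⁻¹ := by
    rw [one_div]
    gcongr
    exact Real.sqrt_le_iff.2 ⟨by norm_num, by linarith [Real.pi_lt_four]⟩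
  calc Real.exp (-x ^ 2 / 2) / 27 = 1 / 3 * (1 / 9 * Real.exp (-x ^ 2 / 2)) := by ring
    _ ≤ (√(2 * Real.pi))⁻¹ * (Real.exp (-2) * Real.exp (-x ^ 2 / 2)) := by gcongr
    _ ≤ (√(2 * Real.pi))⁻¹ * Real.exp (-t ^ 2 / 2) := by
        rw [← Real.exp_add]
        gcongr
        linarith
    _ = gaussianPDFReal 0 1 t := (gaussianPDFReal_zero_one t).symm

lemma exp_neg_sq_half_le_mul_gaussianReal {x : ℝ} (hx : 1 ≤ x) :
    Real.exp (-x ^ 2 / 2) ≤ 27 * x * (gaussianReal 0 1).real {t : ℝ | x < |t|} := by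
  have hx0 : 0 < x := zero_lt_one.trans_le hx
  have hconst : IntegrableOn (fun _ : ℝ => Real.exp (-x ^ 2 / 2) / 27) (Set.Ioc x (x + x⁻¹)) :=
    integrableOn_const measure_Ioc_lt_top.ne
  calc Real.exp (-x ^ 2 / 2)
      = 27 * x * ∫ _ in Set.Ioc x (x + x⁻¹), Real.exp (-x ^ 2 / 2) / 27 := by
        rw [setIntegral_const, Real.volume_real_Ioc_of_le (by simpa using hx0.le),
          add_sub_cancel_left, smul_eq_mul]
        field_simp
    _ ≤ 27 * x * ∫ t in Set.Ioc x (x + x⁻¹), gaussianPDFReal 0 1 t := by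
        refine mul_le_mul_of_nonneg_left ?_ (by positivity)
        exact setIntegral_mono_on hconst (integrable_gaussianPDFReal 0 1).integrableOn
          measurableSet_Ioc fun t ht => exp_neg_sq_half_div_le_gaussianPDFReal hx ht
    _ = 27 * x * (gaussianReal 0 1).real (Set.Ioc x (x + x⁻¹)) := by
        rw [measureReal_def, gaussianReal_apply_eq_integral 0 one_ne_zero, ENNReal.toReal_ofReal
          (setIntegral_nonneg measurableSet_Ioc fun t _ => gaussianPDFReal_nonneg _ _ _)]
    _ ≤ 27 * x * (gaussianReal 0 1).real {t : ℝ | x < |t|} := by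
        refine mul_le_mul_of_nonneg_left (measureReal_mono fun t ht => ?_) (by positivity)
        exact ht.1.trans_le (le_abs_self t)

/-- The conditional second moment `E (X² | |X| > x)` of a standard normal variable `X`, of which
`alpha` is the value at the threshold. -/
def tailSecondMoment (x : ℝ) : ℝ :=
  ⨍ t in {t : ℝ | x < |t|}, t ^ 2 ∂(gaussianReal 0 1)

lemma alpha_eq_tailSecondMoment (s d : ℕ) : alpha s d = tailSecondMoment (threshold s d) := by
  rw [alpha, tailSecondMoment, setAverage_eq, smul_eq_mul, div_eq_inv_mul]

lemma tailSecondMoment_nonneg (x : ℝ) : 0 ≤ tailSecondMoment x :=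
  integral_nonneg fun _ => sq_nonneg _

lemma tailSecondMoment_le {x : ℝ} (hx : 1 ≤ x) : tailSecondMoment x ≤ 2594 * x ^ 2 := by
  set p := (gaussianReal 0 1).real {t : ℝ | x < |t|}
  have htail : Real.exp (-x ^ 2 / 2) ≤ 27 * x * p := exp_neg_sq_half_le_mul_gaussianReal hx
  have hp : 0 < p := pos_of_mul_pos_right ((Real.exp_pos _).trans_le htail) (by positivity)
  have hsq : Integrable (fun t : ℝ => (t ^ 2 - x ^ 2) ^ 2) (gaussianReal 0 1) :=
    (memLp_sq_sub_const_gaussianReal _).integrable_sq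
  rw [tailSecondMoment, setAverage_eq, smul_eq_mul, inv_mul_le_iff₀ hp]
  calc ∫ t in {t : ℝ | x < |t|}, t ^ 2 ∂(gaussianReal 0 1)
      ≤ ∫ t in {t : ℝ | x < |t|}, (x ^ 2 + 1 + (t ^ 2 - x ^ 2) ^ 2) ∂(gaussianReal 0 1) :=
        setIntegral_mono (integrable_pow_gaussianReal 2).integrableOn
          ((integrable_const _).add hsq).integrableOn fun t => by
            nlinarith [sq_nonneg (t ^ 2 - x ^ 2 - 1), sq_nonneg (t ^ 2 - x ^ 2)]
    _ = (x ^ 2 + 1) * p + ∫ t in {t : ℝ | x < |t|}, (t ^ 2 - x ^ 2) ^ 2 ∂(gaussianReal 0 1) := by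
        rw [integral_add (integrable_const _) hsq.integrableOn, setIntegral_const, smul_eq_mul,
          mul_comm]
    _ ≤ (x ^ 2 + 1) * p + 96 * (27 * x * p) := by
        gcongr
        exact (setIntegral_sq_sub_sq_sq_le (zero_le_one.trans hx)).trans (by gcongr)
    _ = p * (x ^ 2 + 1 + 2592 * x) := by ring
    _ ≤ p * (2594 * x ^ 2) := by
        gcongr
        nlinarith

/-- The squared noise recentred to have mean zero on the tail `{|t| > x}`, and `0` off the tail: the
contribution of a pure noise coordinate to the thresholded estimator. -/
def centeredTailSq (x : ℝ) : ℝ → ℝ :=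
  {t : ℝ | x < |t|}.indicator fun t => t ^ 2 - tailSecondMoment x

lemma memLp_centeredTailSq (x : ℝ) : MemLp (centeredTailSq x) 2 (gaussianReal 0 1) :=
  (memLp_sq_sub_const_gaussianReal _).indicator (measurableSet_lt_abs x)

lemma integral_centeredTailSq (x : ℝ) : ∫ t, centeredTailSq x t ∂(gaussianReal 0 1) = 0 := by
  simp only [centeredTailSq]
  rw [integral_indicator (measurableSet_lt_abs x)]
  exact integral_sub_average _ _

lemma integral_centeredTailSq_sq_le {x : ℝ} (hx : 0 ≤ x) :
    ∫ t, centeredTailSq x t ^ 2 ∂(gaussianReal 0 1) ≤ 96 * Real.exp (-x ^ 2 / 2) := by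
  have hsq : ∀ t, centeredTailSq x t ^ 2 =
      {t : ℝ | x < |t|}.indicator (fun t => (t ^ 2 - tailSecondMoment x) ^ 2) t := fun t =>
    (Set.indicator_comp_of_zero (g := fun u : ℝ => u ^ 2) (zero_pow two_ne_zero)).symm ▸ rfl
  simp only [hsq]
  rw [integral_indicator (measurableSet_lt_abs x)]
  exact (integral_sub_average_sq_le (memLp_sq_gaussianReal.restrict _) (x ^ 2)).trans
    (setIntegral_sq_sub_sq_sq_le hx)

end Gaussian

section Product

variable {ι : Type*} [Fintype ι] {X : ι → Type*} [∀ i, MeasurableSpace (X i)]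
  {μ : ∀ i, Measure (X i)} [∀ i, IsProbabilityMeasure (μ i)] {g : ∀ i, X i → ℝ}

lemma memLp_sum_comp_eval (hg : ∀ i, MemLp (g i) 2 (μ i)) :
    MemLp (fun x => ∑ i, g i (x i)) 2 (Measure.pi μ) :=
  memLp_finsetSum _ fun i _ => (hg i).comp_measurePreserving (measurePreserving_eval μ i)

lemma integral_sum_comp_eval_sq (hg : ∀ i, MemLp (g i) 2 (μ i))
    (hmean : ∀ i, ∫ t, g i t ∂(μ i) = 0) :
    ∫ x, (∑ i, g i (x i)) ^ 2 ∂(Measure.pi μ) = ∑ i, ∫ t, g i t ^ 2 ∂(μ i) := by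
  have hint : ∀ i, Integrable (fun x : ∀ i, X i => g i (x i)) (Measure.pi μ) := fun i =>
    integrable_comp_eval ((hg i).integrable one_le_two)
  have hmean_sum : ∫ x, ∑ i, g i (x i) ∂(Measure.pi μ) = 0 := by
    rw [integral_finsetSum _ fun i _ => hint i]
    simp only [integral_comp_eval (hg _).1, hmean, Finset.sum_const_zero]
  have hvar := variance_sum_pi hg
  rw [show (∑ i, fun x : ∀ i, X i => g i (x i)) = fun x => ∑ i, g i (x i) by
      ext x; rw [Finset.sum_apply],
    variance_of_integral_eq_zero (memLp_sum_comp_eval hg).1.aemeasurable hmean_sum] at hvar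
  rw [hvar]
  exact Finset.sum_congr rfl fun i _ =>
    variance_of_integral_eq_zero (hg i).1.aemeasurable (hmean i)

lemma integral_abs_sum_comp_eval_le (hg : ∀ i, MemLp (g i) 2 (μ i))
    (hmean : ∀ i, ∫ t, g i t ∂(μ i) = 0) {B : ℝ} (hB : ∀ i, ∫ t, g i t ^ 2 ∂(μ i) ≤ B) :
    ∫ x, |∑ i, g i (x i)| ∂(Measure.pi μ) ≤ √(Fintype.card ι * B) := by
  refine (integral_abs_le_sqrt_integral_sq (memLp_sum_comp_eval hg)).trans (Real.sqrt_le_sqrt ?_)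
  rw [integral_sum_comp_eval_sq hg hmean, ← nsmul_eq_mul]
  exact Finset.sum_le_card_nsmul _ _ _ fun i _ => hB i

end Product

section Estimator

variable {s d : ℕ} {σ : ℝ}

lemma measurable_quadEstimator (s d : ℕ) (σ : ℝ) : Measurable (quadEstimator s d σ) := by
  unfold quadEstimator
  split_ifs
  · exact Finset.measurable_sum _ fun j _ =>
      Measurable.ite (measurableSet_lt measurable_const (by fun_prop)) (by fun_prop)
        measurable_const
  · fun_prop

lemma measurable_normEstimator (s d : ℕ) (σ : ℝ) : Measurable (normEstimator s d σ) :=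
  ((measurable_quadEstimator s d σ).max measurable_const).sqrt

lemma quadEstimator_smul (s d : ℕ) (hσ : 0 < σ) (z : Fin d → ℝ) :
    quadEstimator s d σ (σ • z) = σ ^ 2 * quadEstimator s d 1 z := by
  simp only [quadEstimator, Pi.smul_apply, smul_eq_mul, abs_mul, abs_of_pos hσ, one_mul, one_pow,
    mul_one, mul_lt_mul_iff_right₀ hσ, mul_pow, ← Finset.mul_sum]
  split_ifs
  · rw [Finset.mul_sum]
    refine Finset.sum_congr rfl fun j _ => ?_
    rw [mul_ite, mul_zero, mul_sub, mul_comm (alpha s d)]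
  · ring

lemma normEstimator_smul (s d : ℕ) (hσ : 0 < σ) (z : Fin d → ℝ) :
    normEstimator s d σ (σ • z) = σ * normEstimator s d 1 z := by
  rw [normEstimator, normEstimator, quadEstimator_smul s d hσ, ← mul_zero (σ ^ 2),
    ← mul_max_of_nonneg _ _ (sq_nonneg σ), Real.sqrt_mul (sq_nonneg σ), Real.sqrt_sq hσ.le,
    mul_zero]

lemma sqrt_sub_sqrt_sq_le {a b : ℝ} (ha : 0 ≤ a) (hb : 0 ≤ b) : (√a - √b) ^ 2 ≤ |a - b| := by
  calc (√a - √b) ^ 2 = |√a - √b| * |√a - √b| := by rw [← sq_abs, sq]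
    _ ≤ |√a - √b| * (√a + √b) := by
        gcongr
        exact (abs_sub _ _).trans_eq (by simp only [abs_of_nonneg (Real.sqrt_nonneg _)])
    _ = |a - b| := by
        rw [← abs_of_nonneg (add_nonneg (Real.sqrt_nonneg a) (Real.sqrt_nonneg b)), ← abs_mul,
          mul_comm, ← sq_sub_sq, Real.sq_sqrt ha, Real.sq_sqrt hb]

lemma sqrt_max_sub_sq_le (q a : ℝ) {u : ℝ} (hu : 0 ≤ u) :
    (√(max q 0) - a) ^ 2 ≤ 2 * |q - u ^ 2| + 2 * (u - a) ^ 2 := by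
  have hsqrt : (√(max q 0) - u) ^ 2 ≤ |q - u ^ 2| := by
    calc (√(max q 0) - u) ^ 2 = (√(max q 0) - √(max (u ^ 2) 0)) ^ 2 := by
          rw [max_eq_left (sq_nonneg u), Real.sqrt_sq hu]
      _ ≤ |max q 0 - max (u ^ 2) 0| := sqrt_sub_sqrt_sq_le (le_max_right _ _) (le_max_right _ _)
      _ ≤ |q - u ^ 2| := abs_max_sub_max_le_abs _ _ _
  nlinarith [sq_nonneg (√(max q 0) - u - (u - a))]

lemma threshold_nonneg (s d : ℕ) : 0 ≤ threshold s d :=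
  Real.sqrt_nonneg _

lemma threshold_sq (s d : ℕ) : threshold s d ^ 2 = 2 * Real.log (1 + (d : ℝ) / s ^ 2) :=
  Real.sq_sqrt (mul_nonneg zero_le_two (log_one_add_nonneg (by positivity)))

lemma exp_neg_threshold_sq_half (hs : 1 ≤ s) :
    Real.exp (-threshold s d ^ 2 / 2) = (s : ℝ) ^ 2 / (s ^ 2 + d) := by
  have : (0 : ℝ) < s := Nat.cast_pos.2 hs
  rw [threshold_sq, neg_div, mul_div_cancel_left₀ _ two_ne_zero, Real.exp_neg,
    Real.exp_log (by positivity)]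
  field_simp

lemma one_le_threshold (hs : 1 ≤ s) (h : (s : ℝ) < √(d : ℝ)) : 1 ≤ threshold s d := by
  have hs0 : (0 : ℝ) < s := Nat.cast_pos.2 hs
  have hratio : 1 ≤ (d : ℝ) / s ^ 2 :=
    (one_le_div (by positivity)).2 ((Real.lt_sqrt hs0.le).1 h).le
  exact Real.le_sqrt_of_sq_le (by linarith [half_le_log_one_add hratio])

end Estimator

section Dense

variable {ι : Type*} [Fintype ι]

/-- The component of `ξ` in the direction of `η`; it is `0` for `η = 0`. -/
def projNoise (η : EuclideanSpace ℝ ι) (ξ : ι → ℝ) : ℝ :=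
  ∑ j, η j / ‖η‖ * ξ j

lemma norm_mul_projNoise (η : EuclideanSpace ℝ ι) (ξ : ι → ℝ) :
    ‖η‖ * projNoise η ξ = ∑ j, η j * ξ j := by
  rcases eq_or_ne η 0 with rfl | hη
  · simp
  · rw [projNoise, Finset.mul_sum]
    refine Finset.sum_congr rfl fun j _ => ?_
    rw [← mul_assoc, mul_div_cancel₀ _ (norm_ne_zero_iff.2 hη)]

lemma sum_add_sq_eq (η : EuclideanSpace ℝ ι) (ξ : ι → ℝ) :
    ∑ j, (η j + ξ j) ^ 2 = (‖η‖ + projNoise η ξ) ^ 2 - projNoise η ξ ^ 2 + ∑ j, ξ j ^ 2 := by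
  have hcross : ∑ j, 2 * η j * ξ j = 2 * (‖η‖ * projNoise η ξ) := by
    rw [norm_mul_projNoise, Finset.mul_sum]
    simp only [mul_assoc]
  simp only [add_sq, Finset.sum_add_distrib]
  rw [hcross, ← EuclideanSpace.real_norm_sq_eq]
  ring

lemma memLp_projNoise (η : EuclideanSpace ℝ ι) : MemLp (projNoise η) 2 (stdGaussianPi ι) :=
  memLp_sum_comp_eval fun j => (memLp_id_gaussianReal 2).const_mul (η j / ‖η‖)

lemma integral_projNoise_sq_le_one (η : EuclideanSpace ℝ ι) :
    ∫ ξ, projNoise η ξ ^ 2 ∂(stdGaussianPi ι) ≤ 1 := by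
  have hmean : ∀ j, ∫ t, η j / ‖η‖ * t ∂(gaussianReal 0 1) = 0 := fun j => by
    rw [integral_const_mul, integral_id_gaussianReal, mul_zero]
  simp only [projNoise]
  rw [integral_sum_comp_eval_sq (g := fun j t => η j / ‖η‖ * t)
    (fun j => (memLp_id_gaussianReal 2).const_mul _) hmean]
  simp only [mul_pow, integral_const_mul, integral_sq_gaussianReal, mul_one, div_pow]
  rw [← Finset.sum_div, ← EuclideanSpace.real_norm_sq_eq]
  exact div_self_le_one _

lemma memLp_sum_sq_sub_one : MemLp (fun ξ => ∑ j, (ξ j ^ 2 - 1)) 2 (stdGaussianPi ι) :=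
  memLp_sum_comp_eval fun _ => memLp_sq_sub_const_gaussianReal 1

lemma integral_abs_sum_sq_sub_one_le :
    ∫ ξ, |∑ j, (ξ j ^ 2 - 1)| ∂(stdGaussianPi ι) ≤ 10 * √(Fintype.card ι : ℝ) := by
  have hmean : ∫ t, (t ^ 2 - 1) ∂(gaussianReal 0 1) = 0 := by
    rw [integral_sub (integrable_pow_gaussianReal 2) (integrable_const _), integral_sq_gaussianReal,
      integral_const, probReal_univ, one_smul, sub_self]
  refine (integral_abs_sum_comp_eval_le (fun _ : ι => memLp_sq_sub_const_gaussianReal 1)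
    (fun _ => hmean) fun _ => integral_sq_sub_one_sq_le).trans ?_
  rw [Real.sqrt_mul (Nat.cast_nonneg _), mul_comm]
  gcongr
  exact Real.sqrt_le_iff.2 ⟨by norm_num, by norm_num⟩

variable {s d : ℕ}

lemma normEstimator_sub_norm_sq_le_of_sqrt_le (h : √(d : ℝ) ≤ s)
    (η : EuclideanSpace ℝ (Fin d)) (ξ : Fin d → ℝ) :
    (normEstimator s d 1 (η.ofLp + ξ) - ‖η‖) ^ 2 ≤
      2 * |∑ j, (ξ j ^ 2 - 1)| + 4 * projNoise η ξ ^ 2 := by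
  set β := projNoise η ξ
  have hquad : quadEstimator s d 1 (η.ofLp + ξ) - |‖η‖ + β| ^ 2 = ∑ j, (ξ j ^ 2 - 1) - β ^ 2 := by
    rw [quadEstimator, if_neg h.not_gt, sq_abs]
    simp only [Pi.add_apply, sum_add_sq_eq, Finset.sum_sub_distrib, Finset.sum_const,
      Finset.card_univ, Fintype.card_fin, nsmul_one]
    ring
  have hnorm : (|‖η‖ + β| - ‖η‖) ^ 2 ≤ β ^ 2 := by
    have habs := abs_abs_sub_abs_le_abs_sub (‖η‖ + β) ‖η‖
    rw [abs_norm, add_sub_cancel_left] at habs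
    exact sq_le_sq.2 habs
  have hnoise : |∑ j, (ξ j ^ 2 - 1) - β ^ 2| ≤ |∑ j, (ξ j ^ 2 - 1)| + β ^ 2 := by
    refine (abs_sub _ _).trans_eq ?_
    rw [abs_sq]
  have hest := sqrt_max_sub_sq_le (quadEstimator s d 1 (η.ofLp + ξ)) ‖η‖ (abs_nonneg (‖η‖ + β))
  rw [hquad] at hest
  rw [normEstimator]
  linarith

lemma lintegral_normEstimator_le_of_sqrt_le (hd : 1 ≤ d) (h : √(d : ℝ) ≤ s)
    (η : EuclideanSpace ℝ (Fin d)) :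
    ∫⁻ ξ, ENNReal.ofReal ((normEstimator s d 1 (η.ofLp + ξ) - ‖η‖) ^ 2) ∂(stdGaussianPi (Fin d)) ≤
      ENNReal.ofReal (24 * √(d : ℝ)) := by
  have hW : Integrable (fun ξ : Fin d → ℝ => 2 * |∑ j, (ξ j ^ 2 - 1)|) (stdGaussianPi (Fin d)) :=
    ((memLp_sum_sq_sub_one.integrable one_le_two).abs).const_mul 2
  have hβ : Integrable (fun ξ => 4 * projNoise η ξ ^ 2) (stdGaussianPi (Fin d)) :=
    (memLp_projNoise η).integrable_sq.const_mul 4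
  refine (lintegral_ofReal_le_ofReal_integral (fun _ => sq_nonneg _)
    (normEstimator_sub_norm_sq_le_of_sqrt_le h η) (hW.add hβ)).trans (ENNReal.ofReal_le_ofReal ?_)
  rw [integral_add hW hβ, integral_const_mul, integral_const_mul]
  have hW1 := integral_abs_sum_sq_sub_one_le (ι := Fin d)
  rw [Fintype.card_fin] at hW1
  have hd1 : 1 ≤ √(d : ℝ) := Real.one_le_sqrt.2 (Nat.one_le_cast.2 hd)
  linarith [integral_projNoise_sq_le_one η]

end Dense

section Sparse

/-- Hard thresholding at level `x`. -/
def hardThreshold (x t : ℝ) : ℝ :=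
  if x < |t| then t else 0

lemma hardThreshold_add_sub_sq_le (x b z : ℝ) :
    (hardThreshold x (b + z) - b) ^ 2 ≤ 2 * (x ^ 2 + z ^ 2) := by
  rw [hardThreshold]
  split_ifs with h
  · nlinarith [sq_nonneg x, sq_nonneg z]
  · have hsmall : (b + z) ^ 2 ≤ x ^ 2 := sq_le_sq.2 ((not_lt.1 h).trans (le_abs_self x))
    nlinarith [sq_nonneg (b + 2 * z)]

lemma memLp_ite_centeredTailSq (x b : ℝ) :
    MemLp (fun t => if b = 0 then centeredTailSq x t else 0) 2 (gaussianReal 0 1) := by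
  split_ifs
  exacts [memLp_centeredTailSq x, MemLp.zero]

variable {ι : Type*} [Fintype ι] {x : ℝ}

/-- The observations `η + ξ` on the support of `η`, hard thresholded at level `x`, and `0` off the
support. -/
def thresholdedSignal (x : ℝ) (η : EuclideanSpace ℝ ι) (ξ : ι → ℝ) : EuclideanSpace ℝ ι :=
  WithLp.toLp 2 fun j => if η j = 0 then 0 else hardThreshold x (η j + ξ j)

/-- The contribution to the thresholded estimator of the coordinates off the support of `η`. -/
def tailNoise (x : ℝ) (η : EuclideanSpace ℝ ι) (ξ : ι → ℝ) : ℝ :=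
  ∑ j, if η j = 0 then centeredTailSq x (ξ j) else 0

/-- A bound, up to a constant, for the squared error of `thresholdedSignal`. -/
def supportError (x : ℝ) (η : EuclideanSpace ℝ ι) (ξ : ι → ℝ) : ℝ :=
  ∑ j, if η j = 0 then 0 else x ^ 2 + ξ j ^ 2

lemma sum_ite_eq_zero_eq_hammingNorm_mul (v : ι → ℝ) (c : ℝ) :
    ∑ j, (if v j = 0 then 0 else c) = hammingNorm v * c := by
  simp only [← ite_not (_ = (0 : ℝ)), ← Finset.sum_filter, Finset.sum_const, nsmul_eq_mul]
  rfl

lemma norm_thresholdedSignal_sub_norm_sq_le (x : ℝ) (η : EuclideanSpace ℝ ι) (ξ : ι → ℝ) :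
    (‖thresholdedSignal x η ξ‖ - ‖η‖) ^ 2 ≤ 2 * supportError x η ξ := by
  calc (‖thresholdedSignal x η ξ‖ - ‖η‖) ^ 2 ≤ ‖thresholdedSignal x η ξ - η‖ ^ 2 :=
        sq_le_sq.2 ((abs_norm_sub_norm_le _ _).trans (le_abs_self _))
    _ ≤ 2 * supportError x η ξ := by
        rw [EuclideanSpace.real_norm_sq_eq, supportError, Finset.mul_sum]
        refine Finset.sum_le_sum fun j _ => ?_
        rw [PiLp.sub_apply, thresholdedSignal]
        split_ifs with hj
        · simp only [hj, if_true, sub_zero, zero_pow two_ne_zero, mul_zero, le_refl]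
        · simp only [hj, if_false]
          exact hardThreshold_add_sub_sq_le _ _ _

lemma abs_thresholded_sum_sub_le (x : ℝ) (η : EuclideanSpace ℝ ι) (ξ : ι → ℝ) :
    |(∑ j, if x < |η j + ξ j| then (η j + ξ j) ^ 2 - tailSecondMoment x else 0) -
        ‖thresholdedSignal x η ξ‖ ^ 2 - tailNoise x η ξ| ≤
      hammingNorm η.ofLp * tailSecondMoment x := by
  rw [EuclideanSpace.real_norm_sq_eq, tailNoise, ← Finset.sum_sub_distrib,
    ← Finset.sum_sub_distrib, ← sum_ite_eq_zero_eq_hammingNorm_mul]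
  refine (Finset.abs_sum_le_sum_abs _ _).trans (Finset.sum_le_sum fun j _ => ?_)
  have hα := tailSecondMoment_nonneg x
  by_cases hj : η j = 0
  · simp [thresholdedSignal, centeredTailSq, Set.indicator_apply, hj]
  · by_cases ht : x < |η j + ξ j| <;>
      simp [thresholdedSignal, hardThreshold, hj, ht, hα, abs_of_nonneg]

lemma memLp_tailNoise (x : ℝ) (η : EuclideanSpace ℝ ι) :
    MemLp (tailNoise x η) 2 (stdGaussianPi ι) :=
  memLp_sum_comp_eval (fun j => memLp_ite_centeredTailSq x (η j))

lemma integral_abs_tailNoise_le (hx : 0 ≤ x) (η : EuclideanSpace ℝ ι) :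
    ∫ ξ, |tailNoise x η ξ| ∂(stdGaussianPi ι) ≤
      √(Fintype.card ι * (96 * Real.exp (-x ^ 2 / 2))) := by
  refine integral_abs_sum_comp_eval_le (fun j => memLp_ite_centeredTailSq x (η j))
    (fun j => ?_) fun j => ?_
  · split_ifs
    exacts [integral_centeredTailSq x, integral_zero _ _]
  · split_ifs
    · exact integral_centeredTailSq_sq_le hx
    · rw [zero_pow two_ne_zero, integral_zero]
      positivity

lemma integrable_eval_sq_stdGaussianPi (j : ι) :
    Integrable (fun ξ : ι → ℝ => ξ j ^ 2) (stdGaussianPi ι) :=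
  integrable_comp_eval (X := fun _ : ι => ℝ) (μ := fun _ => gaussianReal 0 1)
    (f := fun t : ℝ => t ^ 2) (integrable_pow_gaussianReal 2)

lemma integral_eval_sq_stdGaussianPi (j : ι) :
    ∫ ξ : ι → ℝ, ξ j ^ 2 ∂(stdGaussianPi ι) = 1 :=
  (integral_comp_eval (X := fun _ : ι => ℝ) (μ := fun _ => gaussianReal 0 1)
    (f := fun t : ℝ => t ^ 2) (by fun_prop)).trans integral_sq_gaussianReal

lemma integrable_ite_add_sq (x : ℝ) (η : EuclideanSpace ℝ ι) (j : ι) :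
    Integrable (fun ξ : ι → ℝ => if η j = 0 then 0 else x ^ 2 + ξ j ^ 2) (stdGaussianPi ι) := by
  split_ifs
  · exact integrable_zero _ _ _
  · exact (integrable_const _).add (integrable_eval_sq_stdGaussianPi j)

lemma integrable_supportError (x : ℝ) (η : EuclideanSpace ℝ ι) :
    Integrable (supportError x η) (stdGaussianPi ι) :=
  integrable_finsetSum _ fun j _ => integrable_ite_add_sq x η j

lemma integral_supportError (x : ℝ) (η : EuclideanSpace ℝ ι) :
    ∫ ξ, supportError x η ξ ∂(stdGaussianPi ι) = hammingNorm η.ofLp * (x ^ 2 + 1) := by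
  simp only [supportError]
  rw [integral_finsetSum _ fun j _ => integrable_ite_add_sq x η j,
    ← sum_ite_eq_zero_eq_hammingNorm_mul]
  refine Finset.sum_congr rfl fun j _ => ?_
  split_ifs
  · exact integral_zero _ _
  · rw [integral_add (integrable_const _) (integrable_eval_sq_stdGaussianPi j),
      integral_eval_sq_stdGaussianPi, integral_const, probReal_univ, one_smul]

variable {s d : ℕ}

lemma normEstimator_sub_norm_sq_le_of_lt_sqrt (h : (s : ℝ) < √(d : ℝ))
    {η : EuclideanSpace ℝ (Fin d)} (hη : η ∈ sparseClass s d) (ξ : Fin d → ℝ) :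
    (normEstimator s d 1 (η.ofLp + ξ) - ‖η‖) ^ 2 ≤
      2 * |tailNoise (threshold s d) η ξ| + 2 * (s * tailSecondMoment (threshold s d)) +
        4 * supportError (threshold s d) η ξ := by
  set x := threshold s d
  have hbias : |quadEstimator s d 1 (η.ofLp + ξ) - ‖thresholdedSignal x η ξ‖ ^ 2 -
      tailNoise x η ξ| ≤ s * tailSecondMoment x := by
    rw [quadEstimator, if_pos h, one_mul, one_pow, mul_one, alpha_eq_tailSecondMoment]
    refine (abs_thresholded_sum_sub_le x η ξ).trans ?_
    gcongr
    exacts [tailSecondMoment_nonneg x, hη]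
  have hquad := abs_sub_abs_le_abs_sub
    (quadEstimator s d 1 (η.ofLp + ξ) - ‖thresholdedSignal x η ξ‖ ^ 2) (tailNoise x η ξ)
  have hsignal := norm_thresholdedSignal_sub_norm_sq_le x η ξ
  have hest := sqrt_max_sub_sq_le (quadEstimator s d 1 (η.ofLp + ξ)) ‖η‖
    (norm_nonneg (thresholdedSignal x η ξ))
  rw [normEstimator]
  linarith

lemma integral_abs_tailNoise_threshold_le (hs : 1 ≤ s) (η : EuclideanSpace ℝ (Fin d)) :
    ∫ ξ, |tailNoise (threshold s d) η ξ| ∂(stdGaussianPi (Fin d)) ≤ 10 * s := by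
  have : (0 : ℝ) < s := Nat.cast_pos.2 hs
  refine (integral_abs_tailNoise_le (threshold_nonneg s d) η).trans
    (Real.sqrt_le_iff.2 ⟨by positivity, ?_⟩)
  rw [exp_neg_threshold_sq_half hs, Fintype.card_fin]
  calc (d : ℝ) * (96 * ((s : ℝ) ^ 2 / (s ^ 2 + d)))
      = 96 * (s : ℝ) ^ 2 * (d / (s ^ 2 + d)) := by ring
    _ ≤ 96 * (s : ℝ) ^ 2 * 1 := by
        gcongr
        exact (div_le_one (by positivity)).2 (le_add_of_nonneg_left (by positivity))
    _ ≤ (10 * s) ^ 2 := by nlinarith [sq_nonneg (s : ℝ)]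

lemma lintegral_normEstimator_le_of_lt_sqrt (hs : 1 ≤ s) (h : (s : ℝ) < √(d : ℝ))
    {η : EuclideanSpace ℝ (Fin d)} (hη : η ∈ sparseClass s d) :
    ∫⁻ ξ, ENNReal.ofReal ((normEstimator s d 1 (η.ofLp + ξ) - ‖η‖) ^ 2) ∂(stdGaussianPi (Fin d)) ≤
      ENNReal.ofReal (10432 * (s * Real.log (1 + (d : ℝ) / s ^ 2))) := by
  have hx : 1 ≤ threshold s d := one_le_threshold hs h
  have hx2 : 1 ≤ threshold s d ^ 2 := one_le_pow₀ hx
  have hW : Integrable (fun ξ => 2 * |tailNoise (threshold s d) η ξ|) (stdGaussianPi (Fin d)) :=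
    ((memLp_tailNoise _ η).integrable one_le_two).abs.const_mul 2
  have hU : Integrable (fun ξ => 4 * supportError (threshold s d) η ξ) (stdGaussianPi (Fin d)) :=
    (integrable_supportError _ η).const_mul 4
  have hconst : Integrable (fun _ : Fin d → ℝ => 2 * (s * tailSecondMoment (threshold s d)))
      (stdGaussianPi (Fin d)) := integrable_const _
  have hWc : Integrable (fun ξ => 2 * |tailNoise (threshold s d) η ξ| +
      2 * (s * tailSecondMoment (threshold s d))) (stdGaussianPi (Fin d)) := hW.add hconst
  refine (lintegral_ofReal_le_ofReal_integral (fun _ => sq_nonneg _)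
    (normEstimator_sub_norm_sq_le_of_lt_sqrt h hη) (hWc.add hU)).trans
    (ENNReal.ofReal_le_ofReal ?_)
  have hcard : (hammingNorm η.ofLp : ℝ) ≤ s := Nat.cast_le.2 hη
  rw [integral_add hWc hU, integral_add hW hconst, integral_const, probReal_univ, one_smul,
    integral_const_mul, integral_const_mul, integral_supportError]
  calc 2 * ∫ ξ, |tailNoise (threshold s d) η ξ| ∂(stdGaussianPi (Fin d)) +
          2 * (s * tailSecondMoment (threshold s d)) +
          4 * (hammingNorm η.ofLp * (threshold s d ^ 2 + 1))
      ≤ 2 * (10 * s * threshold s d ^ 2) + 2 * (s * (2594 * threshold s d ^ 2)) +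
          4 * (s * (threshold s d ^ 2 + threshold s d ^ 2)) := by
        gcongr
        · exact (integral_abs_tailNoise_threshold_le hs η).trans
            (le_mul_of_one_le_right (by positivity) hx2)
        · exact tailSecondMoment_le hx
    _ = 10432 * (s * Real.log (1 + (d : ℝ) / s ^ 2)) := by
        rw [threshold_sq]
        ring

end Sparse

section UpperBound

variable {s d : ℕ}

lemma lintegral_normEstimator_le (hs : 1 ≤ s) (hsd : s ≤ d) {η : EuclideanSpace ℝ (Fin d)}
    (hη : η ∈ sparseClass s d) :
    ∫⁻ ξ, ENNReal.ofReal ((normEstimator s d 1 (η.ofLp + ξ) - ‖η‖) ^ 2) ∂(stdGaussianPi (Fin d)) ≤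
      ENNReal.ofReal (10432 * normRate s d 1) := by
  rw [normRate, one_pow, one_mul, one_mul]
  split_ifs with h
  · exact lintegral_normEstimator_le_of_lt_sqrt hs h hη
  · refine (lintegral_normEstimator_le_of_sqrt_le (hs.trans hsd) (not_lt.1 h) η).trans ?_
    gcongr
    norm_num

lemma maxRisk_normEstimator_le (hs : 1 ≤ s) (hsd : s ≤ d) {σ : ℝ} (hσ : 0 < σ) :
    maxRisk σ (sparseClass s d) (fun θ => ‖θ‖) (normEstimator s d σ) ≤
      ENNReal.ofReal (10432 * normRate s d σ) := by
  have hscale : (fun z => σ⁻¹ * normEstimator s d σ (σ • z)) = normEstimator s d 1 := by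
    ext z
    rw [normEstimator_smul s d hσ, inv_mul_cancel_left₀ hσ.ne']
  rw [maxRisk_norm_eq_mul smul_mem_sparseClass hσ (measurable_normEstimator s d σ), hscale,
    maxRisk_one _ _ (measurable_normEstimator s d 1), normRate_eq_mul, mul_left_comm,
    ENNReal.ofReal_mul (sq_nonneg σ)]
  gcongr
  exact iSup₂_le fun η hη => lintegral_normEstimator_le hs hsd hη

end UpperBound

end SparseNorm

end

theorem theorem6 :
    ∃ c C : ℝ, 0 < c ∧ 0 < C ∧
      ∀ s d : ℕ, 1 ≤ s → s ≤ d → ∀ σ : ℝ, 0 < σ →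
        Measurable (SparseNorm.normEstimator s d σ) ∧
        SparseNorm.maxRisk σ (SparseNorm.sparseClass s d) (fun θ => ‖θ‖)
            (SparseNorm.normEstimator s d σ) ≤
          ENNReal.ofReal (C * SparseNorm.normRate s d σ) ∧
        ENNReal.ofReal (c * SparseNorm.normRate s d σ) ≤
          SparseNorm.minimaxRisk σ (SparseNorm.sparseClass s d) (fun θ => ‖θ‖) :=
  ⟨1 / 128, 10432, by norm_num, by norm_num, fun s d hs hsd σ hσ =>
    ⟨SparseNorm.measurable_normEstimator s d σ, SparseNorm.maxRisk_normEstimator_le hs hsd hσ,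
      SparseNorm.ofReal_normRate_le_minimaxRisk hs hsd hσ⟩⟩
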